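/- Let $m,n\ge 1$ and let $M=(M_{ij})$ be an $m\times n$ matrix with integer entries. Suppose that $M=SAT$ with $S\in GL_m(\mathbb Z)$, $T\in GL_n(\mathbb Z)$, where $A$ is the Smith normal form of $M$: the $m\times n$ matrix with diagonal entries $\alpha_1,\dots,\alpha_r,0,\dots,0$ and all other entries $0$, where $\alpha_1,\dots,\alpha_r$ are nonzero integers and $\alpha_i\mid\alpha_{i+1}$ for $1\le i<r$. Then there is a (finite, abstract) simplicial complex $K$ of dimension $2$ whose number of vertices $V(K)$ satisfies $$V(K)\;\le\; 2n+m+1+\frac32\sum_{i,j}|M_{ij}|,$$ and whose first integral simplicial homology group is $$H_1(K)\;\cong\;\mathbb Z/\alpha_1\mathbb Z\times\cdots\times\mathbb Z/\alpha_r\mathbb Z\times\mathbb Z^{\,n-r}.$$ -/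

import Mathlib

namespace SimplicialTorsion

/-- The `k`-dimensional faces (those with `k + 1` vertices) of a simplicial complex. -/
abbrev Face {ι : Type*} (K : AbstractSimplicialComplex ι) (k : ℕ) : Type _ :=
  {s : Finset ι // s ∈ K.faces ∧ s.card = k + 1}

/-- The integral simplicial `k`-chains: the free abelian group on the `k`-faces, each face being
oriented by the order of the vertices. -/
abbrev Chain {ι : Type*} (K : AbstractSimplicialComplex ι) (k : ℕ) : Type _ :=
  Face K k →₀ ℤ

/-- The facet of a `(k + 1)`-face `s` opposite to its vertex `v`. -/
def Face.erase {ι : Type*} [DecidableEq ι] {K : AbstractSimplicialComplex ι} {k : ℕ}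
    (s : Face K (k + 1)) (v : ι) (hv : v ∈ s.1) : Face K k :=
  have hcard : (s.1.erase v).card = k + 1 := by
    rw [Finset.card_erase_of_mem hv, s.2.2]; rfl
  ⟨s.1.erase v,
    (K.isRelLowerSet_faces s.2.1).2 (Finset.erase_subset v s.1)
      (Finset.card_pos.mp (by rw [hcard]; exact Nat.succ_pos k)),
    hcard⟩

/-- The simplicial boundary map `C_{k+1}(K) → C_k(K)`. On a face `{v_0 < ⋯ < v_{k+1}}` it is
`∑ i, (-1) ^ i [v_0, …, v_{i-1}, v_{i+1}, …, v_{k+1}]`; the position `i` of a vertex `v` is the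
number of vertices of the face below `v`. -/
noncomputable def boundary {ι : Type*} [LinearOrder ι] (K : AbstractSimplicialComplex ι) (k : ℕ) :
    Chain K (k + 1) →ₗ[ℤ] Chain K k :=
  Finsupp.linearCombination ℤ fun s : Face K (k + 1) =>
    ∑ v : {v // v ∈ s.1},
      Finsupp.single (s.erase v.1 v.2) ((-1 : ℤ) ^ (s.1.filter (fun w => w < v.1)).card)

/-- The simplicial `k`-cycles. -/
noncomputable def cycles {ι : Type*} [LinearOrder ι] (K : AbstractSimplicialComplex ι) :
    (k : ℕ) → Submodule ℤ (Chain K k)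
  | 0 => ⊤
  | k + 1 => LinearMap.ker (boundary K k)

/-- The `k`-th integral (unreduced) simplicial homology group, cycles modulo boundaries. -/
abbrev Homology {ι : Type*} [LinearOrder ι] (K : AbstractSimplicialComplex ι) (k : ℕ) : Type _ :=
  cycles K k ⧸ (LinearMap.range (boundary K k)).submoduleOf (cycles K k)

/-- `K` has dimension `d`: every face has at most `d + 1` vertices, and some face has exactly
`d + 1` vertices. -/
def HasDimension {ι : Type*} (K : AbstractSimplicialComplex ι) (d : ℕ) : Prop :=
  (∀ s ∈ K.faces, s.card ≤ d + 1) ∧ ∃ s ∈ K.faces, s.card = d + 1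

/-- The `m × n` matrix with diagonal entries `α_1, …, α_r, 0, …, 0` and zeros elsewhere. -/
def diagMatrix (m n : ℕ) {r : ℕ} (α : Fin r → ℤ) : Matrix (Fin m) (Fin n) ℤ :=
  Matrix.of fun i j => if h : (i : ℕ) = (j : ℕ) ∧ (i : ℕ) < r then α ⟨i, h.2⟩ else 0

/-- `diag(α_1, …, α_r)`, with nonzero `α_i`, is a Smith normal form of `M` (the `α_i` are
determined up to sign). -/
structure IsSmithNormalForm {m n : ℕ} (M : Matrix (Fin m) (Fin n) ℤ) (r : ℕ) (α : Fin r → ℤ) :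
    Prop where
  le_rows : r ≤ m
  le_cols : r ≤ n
  ne_zero : ∀ i, α i ≠ 0
  dvd : ∀ i j : Fin r, (i : ℕ) + 1 = j → α i ∣ α j
  eq_mul : ∃ (S : Matrix (Fin m) (Fin m) ℤ) (T : Matrix (Fin n) (Fin n) ℤ),
    IsUnit S ∧ IsUnit T ∧ M = S * diagMatrix m n α * T

end SimplicialTorsion

/-!
Up to an isomorphism given by the Smith normal form, the required group is `ℤⁿ` modulo the rows of
`M` (`exists_hom_of_isSmithNormalForm`). The complex is a wedge of `n` triangles, one for each
basis vector, with a disc glued in for each row: the row is written as a word in the signed basis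
vectors `±e_j`, of length `N = ∑ j, |M i j|`, and the boundary of the disc runs along the closed
edge path of length `3 * N` that this word spells in the wedge.

To stay within the bound, the disc of a row has only `3 * N / 2 + 1` inner vertices. The `t`-th one
is joined to the vertices `2 * t`, `2 * t + 1`, `2 * t + 2` of the path. These three are distinct
because the word has no cancellation (`pathVertex_add_two_ne`), so an edge between an inner
vertex and an outer one determines its place on the path, and the cochain below is well defined. Only `H₁` matters, so the inner vertices of a disc may span the full
`2`-skeleton of a simplex. The wedge has `2 * n + 1` vertices, which gives
`2 * n + 1 + ∑ i, (3 * N i / 2 + 1)` altogether, and even a zero row contributes a triangle, so that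
the dimension is `2`.

The triangles are not listed. The edges carry a cochain `vertexStep` with values in `ℤⁿ`, and the
complex is the `flatComplex` that contains every triangle on which this cochain is closed modulo
the rows. By construction it induces a map `H₁(K) → ℤⁿ / rows`, surjective since the triangles of
the wedge go to the `e_j`. For the injectivity, work in the `1`-chains modulo boundaries. There,
up to the coboundary of the paths `treePath`, every edge is the combination of the triangles of the
wedge that `vertexStep` prescribes (`IsEdgeCocycle.eq_of_adj`, by induction along the boundary of
each disc), and the triangle that closes the disc shows that each row bounds
(`IsEdgeCocycle.loopSum_wordSum`). The criterion `nonempty_homology_equiv` then concludes.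
-/

namespace SimplicialTorsion

/-! ### Chains on finite sets of vertices -/

section Chains

variable {ι : Type*} (K : AbstractSimplicialComplex ι)

open Classical in
/-- The elementary `k`-chain on a finite set `s` of vertices. It is `0` when `s` is not a
`k`-face, which lets it be written down without carrying proofs. -/
noncomputable def simplexChain (k : ℕ) (s : Finset ι) : Chain K k :=
  if h : s ∈ K.faces ∧ s.card = k + 1 then Finsupp.single ⟨s, h⟩ 1 else 0

variable {K}

lemma simplexChain_face {k : ℕ} (s : Face K k) :
    simplexChain K k s.1 = Finsupp.single s 1 := by
  rw [simplexChain, dif_pos s.2]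

lemma Face.nonempty {k : ℕ} (s : Face K k) : s.1.Nonempty :=
  (K.isRelLowerSet_faces s.2.1).1

lemma chain_induction {k : ℕ} {P : Chain K k → Prop} (h0 : P 0)
    (hadd : ∀ x y, P x → P y → P (x + y)) (hneg : ∀ x, P x → P (-x))
    (hs : ∀ s ∈ K.faces, s.card = k + 1 → P (simplexChain K k s)) (z : Chain K k) : P z := by
  have hz : z ∈ AddSubgroup.closure (Set.range fun s : Face K k => simplexChain K k s.1) := by
    induction z using Finsupp.induction_linear with
    | zero => exact zero_mem _
    | add f g hf hg => exact add_mem hf hg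
    | single s c =>
      have : (Finsupp.single s c : Chain K k) = c • simplexChain K k s.1 := by
        rw [simplexChain_face, Finsupp.smul_single, smul_eq_mul, mul_one]
      rw [this]
      exact zsmul_mem (AddSubgroup.subset_closure (Set.mem_range_self s)) c
  induction hz using AddSubgroup.closure_induction with
  | mem x hx => obtain ⟨s, rfl⟩ := hx; exact hs _ s.2.1 s.2.2
  | zero => exact h0
  | add x y _ _ hx hy => exact hadd x y hx hy
  | neg x _ hx => exact hneg x hx

variable [LinearOrder ι]

lemma boundary_simplexChain {k : ℕ} {s : Finset ι} (hs : s ∈ K.faces) (hc : s.card = k + 2) :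
    boundary K k (simplexChain K (k + 1) s) =
      ∑ v ∈ s, (-1 : ℤ) ^ (s.filter (fun w => w < v)).card • simplexChain K k (s.erase v) := by
  rw [simplexChain, dif_pos ⟨hs, hc⟩, boundary, Finsupp.linearCombination_single, one_smul,
    ← Finset.sum_coe_sort s]
  refine Finset.sum_congr rfl fun v _ => ?_
  have h := simplexChain_face (Face.erase (⟨s, hs, hc⟩ : Face K (k + 1)) v.1 v.2)
  rw [← Finsupp.smul_single_one, ← h]
  rfl

lemma boundary_edge {a b : ι} (hab : a < b) (h : {a, b} ∈ K.faces) :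
    boundary K 0 (simplexChain K 1 {a, b}) = simplexChain K 0 {b} - simplexChain K 0 {a} := by
  rw [boundary_simplexChain h (Finset.card_pair hab.ne), Finset.sum_pair hab.ne]
  have h1 : ({a, b} : Finset ι).erase a = {b} := by grind
  have h2 : ({a, b} : Finset ι).erase b = {a} := by grind
  have h3 : ({a, b} : Finset ι).filter (fun w => w < a) = ∅ := by grind
  have h4 : ({a, b} : Finset ι).filter (fun w => w < b) = {a} := by grind
  rw [h1, h2, h3, h4]
  simp [sub_eq_add_neg]

lemma boundary_triangle {a b c : ι} (hab : a < b) (hbc : b < c) (h : {a, b, c} ∈ K.faces) :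
    boundary K 1 (simplexChain K 2 {a, b, c}) =
      simplexChain K 1 {b, c} - simplexChain K 1 {a, c} + simplexChain K 1 {a, b} := by
  have hac := hab.trans hbc
  rw [boundary_simplexChain h (Finset.card_eq_three.2 ⟨a, b, c, hab.ne, hac.ne, hbc.ne, rfl⟩),
    Finset.sum_insert (by grind), Finset.sum_pair hbc.ne]
  have h1 : ({a, b, c} : Finset ι).erase a = {b, c} := by grind
  have h2 : ({a, b, c} : Finset ι).erase b = {a, c} := by grind
  have h3 : ({a, b, c} : Finset ι).erase c = {a, b} := by grind
  have h4 : ({a, b, c} : Finset ι).filter (fun w => w < a) = ∅ := by grind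
  have h5 : ({a, b, c} : Finset ι).filter (fun w => w < b) = {a} := by grind
  have h6 : ({a, b, c} : Finset ι).filter (fun w => w < c) = {a, b} := by grind
  rw [h1, h2, h3, h4, h5, h6, Finset.card_pair hab.ne]
  simp
  abel

lemma exists_lt_of_card_eq_two {s : Finset ι} (hs : s.card = 2) :
    ∃ a b, a < b ∧ s = {a, b} := by
  obtain ⟨a, b, hab, rfl⟩ := Finset.card_eq_two.1 hs
  rcases hab.lt_or_gt with h | h
  · exact ⟨a, b, h, rfl⟩
  · exact ⟨b, a, h, Finset.pair_comm a b⟩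

lemma exists_lt_of_card_eq_three {s : Finset ι} (hs : s.card = 3) :
    ∃ a b c, a < b ∧ b < c ∧ s = {a, b, c} := by
  refine ⟨s.orderEmbOfFin hs 0, s.orderEmbOfFin hs 1, s.orderEmbOfFin hs 2, ?_, ?_, ?_⟩
  · exact (s.orderEmbOfFin hs).strictMono (by decide)
  · exact (s.orderEmbOfFin hs).strictMono (by decide)
  · ext x
    rw [← Finset.mem_coe, ← Finset.range_orderEmbOfFin s hs, Set.mem_range, Fin.exists_fin_succ,
      Fin.exists_fin_two]
    simp only [Finset.mem_insert, Finset.mem_singleton, eq_comm (a := x)]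
    rfl

end Chains

/-! ### The universal cocycle -/

section Cocycle

variable {ι : Type*} {G : Type*} [AddCommGroup G]

/-- An antisymmetric function satisfies the cocycle identity on all triples, degenerate and
unordered ones included, once it does so on increasing triples. -/
lemma cocycle_of_lt [LinearOrder ι] {g : ι → ι → G} (hg : ∀ a b, g b a = -g a b)
    (hd : ∀ a, g a a = 0) {s : Finset ι}
    (h : ∀ a ∈ s, ∀ b ∈ s, ∀ c ∈ s, a < b → b < c → g a b + g b c = g a c)
    {a b c : ι} (ha : a ∈ s) (hb : b ∈ s) (hc : c ∈ s) : g a b + g b c = g a c := by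
  rcases lt_trichotomy a b with h1 | rfl | h1
  · rcases lt_trichotomy b c with h2 | rfl | h2
    · exact h a ha b hb c hc h1 h2
    · simp [hd]
    · rcases lt_trichotomy a c with h3 | rfl | h3
      · rw [hg c b, ← h a ha c hc b hb h3 h2]; abel
      · rw [hg a b, hd]; abel
      · rw [hg c b, hg c a, ← h c hc a ha b hb h3 h1]; abel
  · simp [hd]
  · rcases lt_trichotomy b c with h2 | rfl | h2
    · rcases lt_trichotomy a c with h3 | rfl | h3
      · rw [hg b a, ← h b hb a ha c hc h1 h3]; abel
      · rw [hg b a, hd]; abel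
      · rw [hg b a, hg c a, ← h b hb c hc a ha h2 h3]; abel
    · simp [hd]
    · rw [hg b a, hg c b, hg c a, ← h c hc b hb a ha h2 h1]; abel

variable [LinearOrder ι] (K : AbstractSimplicialComplex ι)

/-- The `1`-chains modulo boundaries. The first homology group is the kernel of the map that the
boundary induces on it. -/
abbrev ChainModBoundary : Type _ := Chain K 1 ⧸ LinearMap.range (boundary K 1)

/-- The class of the oriented edge from `a` to `b`, modulo boundaries. It is the universal
`1`-cocycle of `K`, in non-homogeneous form: antisymmetric, and additive along triangles. -/
noncomputable def edgeClass (a b : ι) : ChainModBoundary K :=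
  if a < b then Submodule.Quotient.mk (simplexChain K 1 {a, b})
  else if b < a then -Submodule.Quotient.mk (simplexChain K 1 {b, a})
  else 0

lemma edgeClass_self (a : ι) : edgeClass K a a = 0 := by simp [edgeClass]

lemma edgeClass_swap (a b : ι) : edgeClass K b a = -edgeClass K a b := by
  rcases lt_trichotomy a b with h | rfl | h
  · simp [edgeClass, h, h.not_gt]
  · simp [edgeClass]
  · simp [edgeClass, h, h.not_gt]

variable {K}

lemma edgeClass_of_lt {a b : ι} (h : a < b) :
    edgeClass K a b = Submodule.Quotient.mk (simplexChain K 1 {a, b}) := by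
  simp [edgeClass, h]

lemma edgeClass_add {s : Finset ι} (hs : s ∈ K.faces) {a b c : ι} (ha : a ∈ s) (hb : b ∈ s)
    (hc : c ∈ s) : edgeClass K a b + edgeClass K b c = edgeClass K a c := by
  refine cocycle_of_lt (edgeClass_swap K) (edgeClass_self K) ?_ ha hb hc
  intro a ha b hb c hc hab hbc
  have hf : {a, b, c} ∈ K.faces := (K.isRelLowerSet_faces hs).2
    (by simp [Finset.insert_subset_iff, ha, hb, hc]) (by simp)
  rw [edgeClass_of_lt hab, edgeClass_of_lt hbc, edgeClass_of_lt (hab.trans hbc),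
    ← Submodule.Quotient.mk_add, Submodule.Quotient.eq]
  exact ⟨_, (boundary_triangle hab hbc hf).trans (by abel)⟩

section Lift

variable (φ : ι → ι → G)

/-- The map on `1`-chains that integrates `φ`. -/
noncomputable def evalChain (K : AbstractSimplicialComplex ι) : Chain K 1 →ₗ[ℤ] G :=
  Finsupp.linearCombination ℤ fun e : Face K 1 =>
    φ (e.1.min' e.nonempty) (e.1.max' e.nonempty)

lemma evalChain_edge {a b : ι} (hab : a < b) (h : {a, b} ∈ K.faces) :
    evalChain φ K (simplexChain K 1 {a, b}) = φ a b := by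
  rw [simplexChain, dif_pos ⟨h, Finset.card_pair hab.ne⟩, evalChain,
    Finsupp.linearCombination_single, one_smul]
  have h1 : ({a, b} : Finset ι).min' (by simp) = a := by
    rw [Finset.min'_pair, min_eq_left hab.le]
  have h2 : ({a, b} : Finset ι).max' (by simp) = b := by
    rw [Finset.max'_pair, max_eq_right hab.le]
  exact congrArg₂ φ h1 h2

variable {φ}

lemma evalChain_boundary (hφ : ∀ s ∈ K.faces, ∀ a ∈ s, ∀ b ∈ s, ∀ c ∈ s, φ a b + φ b c = φ a c)
    (z : Chain K 2) : evalChain φ K (boundary K 1 z) = 0 := by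
  induction z using chain_induction with
  | h0 => simp
  | hadd x y hx hy => rw [map_add, map_add, hx, hy, add_zero]
  | hneg x hx => rw [map_neg, map_neg, hx, neg_zero]
  | hs s hs hc =>
    obtain ⟨a, b, c, hab, hbc, rfl⟩ := exists_lt_of_card_eq_three hc
    have hsub : ∀ x ∈ ({a, b, c} : Finset ι), ∀ y ∈ ({a, b, c} : Finset ι), {x, y} ∈ K.faces :=
      fun x hx y hy => (K.isRelLowerSet_faces hs).2
        (by simp only [Finset.insert_subset_iff, Finset.singleton_subset_iff]; exact ⟨hx, hy⟩)
        (by simp)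
    rw [boundary_triangle hab hbc hs, map_add, map_sub,
      evalChain_edge φ hbc (hsub _ (by simp) _ (by simp)),
      evalChain_edge φ (hab.trans hbc) (hsub _ (by simp) _ (by simp)),
      evalChain_edge φ hab (hsub _ (by simp) _ (by simp)),
      ← hφ _ hs a (by simp) b (by simp) c (by simp)]
    abel

/-- The homomorphism out of `ChainModBoundary K` that a cocycle `φ` defines. -/
noncomputable def cocycleLift
    (hφ : ∀ s ∈ K.faces, ∀ a ∈ s, ∀ b ∈ s, ∀ c ∈ s, φ a b + φ b c = φ a c) :
    ChainModBoundary K →ₗ[ℤ] G :=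
  (LinearMap.range (boundary K 1)).liftQ (evalChain φ K) (by
    rintro _ ⟨z, rfl⟩
    exact evalChain_boundary hφ z)

lemma cocycleLift_edgeClass
    (hφ : ∀ s ∈ K.faces, ∀ a ∈ s, ∀ b ∈ s, ∀ c ∈ s, φ a b + φ b c = φ a c)
    {a b : ι} (h : {a, b} ∈ K.faces) : cocycleLift hφ (edgeClass K a b) = φ a b := by
  have hself : ∀ x ∈ ({a, b} : Finset ι), φ x x = 0 := fun x hx => by
    simpa using hφ _ h x hx x hx x hx
  rcases lt_trichotomy a b with hab | rfl | hab
  · rw [edgeClass_of_lt hab]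
    exact evalChain_edge φ hab h
  · rw [edgeClass_self, map_zero, hself a (by simp)]
  · rw [edgeClass_swap, edgeClass_of_lt hab, map_neg]
    have h1 : cocycleLift hφ (Submodule.Quotient.mk (simplexChain K 1 {b, a})) = φ b a :=
      evalChain_edge φ hab (Finset.pair_comm a b ▸ h)
    rw [h1, neg_eq_iff_add_eq_zero, hφ _ h b (by simp) a (by simp) b (by simp),
      hself b (by simp)]

end Lift

lemma boundary_comp (z : Chain K 2) : boundary K 0 (boundary K 1 z) = 0 := by
  induction z using chain_induction with
  | h0 => simp
  | hadd x y hx hy => rw [map_add, map_add, hx, hy, add_zero]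
  | hneg x hx => rw [map_neg, map_neg, hx, neg_zero]
  | hs s hs hc =>
    obtain ⟨a, b, c, hab, hbc, rfl⟩ := exists_lt_of_card_eq_three hc
    have hsub : ∀ x ∈ ({a, b, c} : Finset ι), ∀ y ∈ ({a, b, c} : Finset ι), {x, y} ∈ K.faces :=
      fun x hx y hy => (K.isRelLowerSet_faces hs).2
        (by simp only [Finset.insert_subset_iff, Finset.singleton_subset_iff]; exact ⟨hx, hy⟩)
        (by simp)
    rw [boundary_triangle hab hbc hs, map_add, map_sub,
      boundary_edge hbc (hsub _ (by simp) _ (by simp)),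
      boundary_edge (hab.trans hbc) (hsub _ (by simp) _ (by simp)),
      boundary_edge hab (hsub _ (by simp) _ (by simp))]
    abel

/-- The boundary of a `1`-chain, as a map on `1`-chains modulo boundaries. -/
noncomputable def boundaryLift (K : AbstractSimplicialComplex ι) :
    ChainModBoundary K →ₗ[ℤ] Chain K 0 :=
  (LinearMap.range (boundary K 1)).liftQ (boundary K 0) (by
    rintro _ ⟨z, rfl⟩
    exact boundary_comp z)

lemma boundaryLift_edgeClass {a b : ι} (h : {a, b} ∈ K.faces) :
    boundaryLift K (edgeClass K a b) = simplexChain K 0 {b} - simplexChain K 0 {a} := by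
  rcases lt_trichotomy a b with hab | rfl | hab
  · rw [edgeClass_of_lt hab]
    exact boundary_edge hab h
  · rw [edgeClass_self, map_zero, sub_self]
  · rw [edgeClass_swap, edgeClass_of_lt hab, map_neg, neg_eq_iff_eq_neg, neg_sub]
    exact boundary_edge hab (Finset.pair_comm a b ▸ h)

/-! ### Reading off the first homology group -/

/-- A criterion for `H₁(K) ≅ A`. Let `φ` be a cocycle with values in `A`, and let `γ` be a family
of cycles, additively parametrized by `F`. If, up to the coboundary of some `p`, the class of every
edge is in the range of `γ`, then every cycle is homologous to some `γ c`; so `φ` identifies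
`H₁(K)` with `A` when `φ (γ c) = π c` for a surjection `π` whose kernel `γ` kills. -/
theorem nonempty_homology_equiv {F A : Type*} [AddCommGroup F] [AddCommGroup A]
    {φ : ι → ι → A} (hφ : ∀ s ∈ K.faces, ∀ a ∈ s, ∀ b ∈ s, ∀ c ∈ s, φ a b + φ b c = φ a c)
    (γ : F →+ ChainModBoundary K) (π : F →+ A) (p : ι → ChainModBoundary K)
    (hγ : ∀ c, boundaryLift K (γ c) = 0)
    (hedge : ∀ a b, {a, b} ∈ K.faces → edgeClass K a b + p a - p b ∈ γ.range)
    (heval : ∀ c, cocycleLift hφ (γ c) = π c) (hπ : Function.Surjective π)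
    (hker : ∀ c, π c = 0 → γ c = 0) :
    Nonempty (Homology K 1 ≃+ A) := by
  -- `p` extended to a homomorphism on `0`-chains
  let P : Chain K 0 →ₗ[ℤ] ChainModBoundary K :=
    Finsupp.linearCombination ℤ fun s : Face K 0 =>
      p (s.1.min' s.nonempty)
  have hP : ∀ v, P (simplexChain K 0 {v}) = p v := fun v => by
    simp only [P]
    rw [simplexChain, dif_pos ⟨K.singleton_mem v, Finset.card_singleton v⟩,
      Finsupp.linearCombination_single, one_smul]
    exact congrArg p (Finset.min'_singleton v)
  have hmem : ∀ z : Chain K 1,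
      (Submodule.Quotient.mk z : ChainModBoundary K) - P (boundary K 0 z) ∈ γ.range := by
    intro z
    induction z using chain_induction with
    | h0 => simp
    | hadd x y hx hy =>
      have := add_mem hx hy
      rw [Submodule.Quotient.mk_add, map_add, map_add]
      convert this using 1
      abel
    | hneg x hx =>
      have := neg_mem hx
      rw [Submodule.Quotient.mk_neg, map_neg, map_neg]
      convert this using 1
      abel
    | hs s hs hc =>
      obtain ⟨a, b, hab, rfl⟩ := exists_lt_of_card_eq_two hc
      have := hedge a b hs
      rw [boundary_edge hab hs, map_sub, hP, hP, ← edgeClass_of_lt hab]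
      convert this using 1
      abel
  let f : cycles K 1 →ₗ[ℤ] A :=
    cocycleLift hφ ∘ₗ (LinearMap.range (boundary K 1)).mkQ ∘ₗ (cycles K 1).subtype
  have hf : Function.Surjective f := by
    intro x
    obtain ⟨c, rfl⟩ := hπ x
    obtain ⟨z, hz⟩ := Submodule.Quotient.mk_surjective _ (γ c)
    have hcyc : boundary K 0 z = 0 := by
      have := hγ c
      rw [← hz] at this
      exact this
    exact ⟨⟨z, hcyc⟩, (congrArg (cocycleLift hφ) hz).trans (heval c)⟩
  have hk : LinearMap.ker f = (LinearMap.range (boundary K 1)).submoduleOf (cycles K 1) := by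
    ext z
    constructor
    · intro hz
      have hz' : cocycleLift hφ (Submodule.Quotient.mk z.1) = 0 := hz
      have hcyc : boundary K 0 z.1 = 0 := z.2
      obtain ⟨c, hc⟩ := hmem z.1
      rw [hcyc, map_zero, sub_zero] at hc
      rw [← hc, heval] at hz'
      rw [hker c hz'] at hc
      exact (Submodule.Quotient.mk_eq_zero (LinearMap.range (boundary K 1))).1 hc.symm
    · intro hz
      have : (Submodule.Quotient.mk z.1 : ChainModBoundary K) = 0 :=
        (Submodule.Quotient.mk_eq_zero _).2 hz
      change cocycleLift hφ (Submodule.Quotient.mk z.1) = 0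
      rw [this, map_zero]
  exact ⟨((Submodule.quotEquivOfEq _ _ hk.symm).trans
    (f.quotKerEquivOfSurjective hf)).toAddEquiv⟩

end Cocycle


/-! ### Flat complexes -/

section Flat

variable {ι A : Type*} [AddCommGroup A]

/-- The complex of dimension at most `2` whose faces are the cliques of `adj` with at most three vertices
on which `φ` satisfies the cocycle identity. It is the largest complex with these edges, and
without faces of higher dimension, on which `φ` is a cocycle. -/
def flatComplex (adj : ι → ι → Prop) (φ : ι → ι → A) (hrefl : ∀ a, adj a a)
    (hself : ∀ a, φ a a = 0) : AbstractSimplicialComplex ι where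
  faces := {s | s.Nonempty ∧ s.card ≤ 3 ∧ (∀ a ∈ s, ∀ b ∈ s, adj a b) ∧
    ∀ a ∈ s, ∀ b ∈ s, ∀ c ∈ s, φ a b + φ b c = φ a c}
  isRelLowerSet_faces := fun s hs => ⟨hs.1, fun t hts ht => ⟨ht,
    (Finset.card_le_card hts).trans hs.2.1, fun a ha b hb => hs.2.2.1 a (hts ha) b (hts hb),
    fun a ha b hb c hc => hs.2.2.2 a (hts ha) b (hts hb) c (hts hc)⟩⟩
  singleton_mem := fun v => by simp [hrefl, hself]

variable {adj : ι → ι → Prop} {φ : ι → ι → A} {hrefl : ∀ a, adj a a} {hself : ∀ a, φ a a = 0}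

lemma triple_mem_flatComplex [DecidableEq ι] (hsymm : ∀ a b, adj a b → adj b a)
    (hswap : ∀ a b, φ b a = -φ a b) {a b c : ι} (hab : adj a b) (hbc : adj b c) (hac : adj a c)
    (h : φ a b + φ b c = φ a c) : {a, b, c} ∈ (flatComplex adj φ hrefl hself).faces := by
  refine ⟨by simp, Finset.card_le_three, ?_, ?_⟩
  · simp only [Finset.mem_insert, Finset.mem_singleton]
    rintro x (rfl | rfl | rfl) y (rfl | rfl | rfl) <;>
      first | exact hrefl _ | assumption | (apply hsymm; assumption)
  · have h1 := hswap a b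
    have h2 := hswap b c
    have h3 := hswap a c
    simp only [Finset.mem_insert, Finset.mem_singleton]
    rintro x (rfl | rfl | rfl) y (rfl | rfl | rfl) z (rfl | rfl | rfl) <;>
      simp only [hself, h1, h2, h3, ← h] <;> abel

end Flat

/-! ### Words in signed basis vectors -/

section Words

variable {n : ℕ}

/-- The vector of a letter: the basis vector `e_j` for `(j, true)` and `-e_j` for `(j, false)`. -/
def letterVec (x : Fin n × Bool) : Fin n → ℤ := Pi.single x.1 (if x.2 then 1 else -1)

/-- The sum of the vectors of the first `l` letters of a word. -/
def wordSum (w : ℕ → Fin n × Bool) (l : ℕ) : Fin n → ℤ := ∑ x ∈ Finset.range l, letterVec (w x)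

/-- A word without cancellation: no letter is followed by its inverse. -/
def IsReduced (w : ℕ → Fin n × Bool) : Prop :=
  ∀ l, (w l).1 = (w (l + 1)).1 → (w l).2 = (w (l + 1)).2

/-- Induction for `exists_reduced_word`. The signs `σ` of the letters are fixed in advance, since
the sign of `c j` is lost once `c j` has been reduced to `0`. -/
lemma exists_word_of_signs (hn : 0 < n) (σ : Fin n → Bool) (N : ℕ) (c : Fin n → ℤ)
    (hσ : ∀ j, c j ≠ 0 → σ j = decide (0 < c j)) (hc : ∑ j, (c j).natAbs = N) :
    ∃ w : ℕ → Fin n, wordSum (fun l => (w l, σ (w l))) N = c := by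
  induction N generalizing c with
  | zero =>
    refine ⟨fun _ => ⟨0, hn⟩, ?_⟩
    funext j
    have h0 : ∀ j, c j = 0 := by simpa using hc
    simp [wordSum, h0]
  | succ N ih =>
    obtain ⟨j, hj⟩ : ∃ j, c j ≠ 0 := by
      by_contra! h
      simp [h] at hc
    obtain ⟨w, hw⟩ := ih (c - letterVec (j, σ j))
      (by
        intro i hi
        by_cases hij : i = j
        · subst hij
          rw [hσ i hj] at hi ⊢
          simp only [letterVec, Pi.sub_apply, Pi.single_eq_same, decide_eq_true_eq] at hi ⊢
          rw [decide_eq_decide]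
          split_ifs at hi ⊢ <;> omega
        · simp only [letterVec, Pi.sub_apply, ne_eq, hij, not_false_eq_true,
            Pi.single_eq_of_ne, sub_zero] at hi ⊢
          exact hσ i hi)
      (by
        rw [← Finset.add_sum_erase _ _ (Finset.mem_univ j)] at hc ⊢
        have h1 : ∀ i ∈ Finset.univ.erase j,
            ((c - letterVec (j, σ j)) i).natAbs = (c i).natAbs := fun i hi => by
          simp [letterVec, Finset.ne_of_mem_erase hi]
        rw [Finset.sum_congr rfl h1, hσ j hj]
        simp only [letterVec, Pi.sub_apply, Pi.single_eq_same, decide_eq_true_eq]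
        split_ifs <;> omega)
    refine ⟨Function.update w N j, ?_⟩
    have h2 : ∑ x ∈ Finset.range N,
        letterVec (Function.update w N j x, σ (Function.update w N j x)) =
        wordSum (fun l => (w l, σ (w l))) N := Finset.sum_congr rfl fun x hx => by
      rw [Function.update_of_ne (Finset.mem_range.1 hx).ne]
    rw [wordSum, Finset.sum_range_succ, h2, hw, Function.update_self, sub_add_cancel]

/-- An integer vector is the sum of as many signed basis vectors as its `ℓ¹`-norm, in an order
without cancellation. -/
lemma exists_reduced_word (hn : 0 < n) (c : Fin n → ℤ) :
    ∃ w : ℕ → Fin n × Bool, IsReduced w ∧ wordSum w (∑ j, (c j).natAbs) = c := by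
  obtain ⟨w, hw⟩ := exists_word_of_signs hn (fun j => decide (0 < c j)) _ c (fun _ _ => rfl) rfl
  exact ⟨_, fun l h => congrArg (fun j => decide (0 < c j)) h, hw⟩

end Words

/-! ### The edge path of a word in a wedge of triangles -/

section Path

variable {n : ℕ}

/-- The vertices of a wedge of `n` triangles: the base vertex `none`, and the vertices
`some (j, true)` and `some (j, false)` of the `j`-th triangle. The closed path through
`none`, `(j, true)`, `(j, false)` spells the letter `(j, true)`; its inverse spells `(j, false)`. -/
abbrev OuterVertex (n : ℕ) : Type := Option (Fin n × Bool)

/-- Being equal or adjacent in the wedge of triangles. -/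
def outerAdj : OuterVertex n → OuterVertex n → Prop
  | some x, some y => x.1 = y.1
  | _, _ => True

/-- The integral cocycle on the wedge of triangles with value `e_j` on the `j`-th triangle,
concentrated on the edges that miss the base vertex. -/
def outerStep : OuterVertex n → OuterVertex n → (Fin n → ℤ)
  | some x, some y => if x.1 = y.1 ∧ x.2 ≠ y.2 then letterVec x else 0
  | _, _ => 0

lemma outerAdj_refl (a : OuterVertex n) : outerAdj a a := by
  cases a <;> simp [outerAdj]

lemma outerAdj_symm {a b : OuterVertex n} (h : outerAdj a b) : outerAdj b a := by
  cases a <;> cases b <;> simp_all [outerAdj]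

lemma outerStep_swap (a b : OuterVertex n) : outerStep b a = -outerStep a b := by
  rcases a with _ | ⟨j, s⟩ <;> rcases b with _ | ⟨j', s'⟩ <;> simp only [outerStep, neg_zero]
  by_cases h : j = j'
  · subst h
    cases s <;> cases s' <;> simp [letterVec, Pi.single_neg]
  · simp [h, Ne.symm h]

/-- The closed path in the wedge of triangles that a word spells, three steps per letter. -/
def pathVertex (w : ℕ → Fin n × Bool) (q : ℕ) : OuterVertex n :=
  if q % 3 = 0 then none
  else if q % 3 = 1 then some (w (q / 3))
  else some ((w (q / 3)).1, !(w (q / 3)).2)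

/-- The integral of `outerStep` along the first `q` steps of the path of a word; only the middle
step of each letter contributes. -/
def pathSum (w : ℕ → Fin n × Bool) (q : ℕ) : Fin n → ℤ := wordSum w ((q + 1) / 3)

variable (w : ℕ → Fin n × Bool)

lemma pathVertex_zero_add (l : ℕ) : pathVertex w (3 * l) = none := by
  simp [pathVertex]

lemma pathVertex_one_add (l : ℕ) : pathVertex w (3 * l + 1) = some (w l) := by
  have h1 : (3 * l + 1) % 3 = 1 := by omega
  have h2 : (3 * l + 1) / 3 = l := by omega
  simp [pathVertex, h1, h2]

lemma pathVertex_two_add (l : ℕ) : pathVertex w (3 * l + 2) = some ((w l).1, !(w l).2) := by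
  have h1 : (3 * l + 2) % 3 = 2 := by omega
  have h2 : (3 * l + 2) / 3 = l := by omega
  simp [pathVertex, h1, h2]

lemma exists_eq_three_mul_add (q : ℕ) : ∃ l, q = 3 * l ∨ q = 3 * l + 1 ∨ q = 3 * l + 2 :=
  ⟨q / 3, by omega⟩

lemma outerAdj_pathVertex (q : ℕ) : outerAdj (pathVertex w q) (pathVertex w (q + 1)) := by
  obtain ⟨l, rfl | rfl | rfl⟩ := exists_eq_three_mul_add q
  · rw [pathVertex_zero_add]
    simp [outerAdj]
  · rw [pathVertex_one_add, pathVertex_two_add]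
    simp [outerAdj]
  · rw [show 3 * l + 2 + 1 = 3 * (l + 1) by ring, pathVertex_zero_add]
    simp [outerAdj]

lemma outerStep_pathVertex (q : ℕ) :
    outerStep (pathVertex w q) (pathVertex w (q + 1)) = pathSum w (q + 1) - pathSum w q := by
  obtain ⟨l, rfl | rfl | rfl⟩ := exists_eq_three_mul_add q
  · rw [pathVertex_zero_add, pathSum, pathSum, show (3 * l + 1 + 1) / 3 = (3 * l + 1) / 3 by omega]
    simp [outerStep]
  · rw [pathVertex_one_add, pathVertex_two_add, pathSum, pathSum,
      show (3 * l + 1 + 1 + 1) / 3 = l + 1 by omega, show (3 * l + 1 + 1) / 3 = l by omega]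
    simp [outerStep, wordSum, Finset.sum_range_succ]
  · rw [show 3 * l + 2 + 1 = 3 * (l + 1) by ring, pathVertex_zero_add, pathSum, pathSum,
      show (3 * (l + 1) + 1) / 3 = (3 * l + 2 + 1) / 3 by omega]
    simp [outerStep]

lemma pathVertex_add_one_ne (q : ℕ) : pathVertex w (q + 1) ≠ pathVertex w q := by
  obtain ⟨l, rfl | rfl | rfl⟩ := exists_eq_three_mul_add q
  · simp [pathVertex_zero_add, pathVertex_one_add]
  · rw [pathVertex_two_add, pathVertex_one_add]
    intro h
    simpa using congrArg Prod.snd (Option.some.inj h)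
  · rw [show 3 * l + 2 + 1 = 3 * (l + 1) by ring, pathVertex_zero_add, pathVertex_two_add]
    simp

variable {w}

lemma pathVertex_add_two_ne (hw : IsReduced w) (q : ℕ) :
    pathVertex w (q + 2) ≠ pathVertex w q := by
  obtain ⟨l, rfl | rfl | rfl⟩ := exists_eq_three_mul_add q
  · simp [pathVertex_zero_add, pathVertex_two_add]
  · rw [show 3 * l + 1 + 2 = 3 * (l + 1) by ring, pathVertex_zero_add, pathVertex_one_add]
    simp
  · rw [show 3 * l + 2 + 2 = 3 * (l + 1) + 1 by ring, pathVertex_one_add, pathVertex_two_add]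
    intro h
    have h' := Option.some.inj h
    have h1 := hw l (congrArg Prod.fst h').symm
    rw [h'] at h1
    simp at h1

end Path

/-! ### The complex of a family of words -/

section Vertex

variable {m n : ℕ}

/-- The vertices of the complex: those of a wedge of `n` triangles, and, for each word `i`, the
`k i + 1` vertices inside the disc that is glued in along its path. Words are infinite sequences,
and with `k i = 3 * N / 2` the last inner vertex can also see up to two path vertices past
`3 * N`. These only add a collar to the disc and do not affect the homology. -/
abbrev Vertex (n : ℕ) (k : Fin m → ℕ) : Type := OuterVertex n ⊕ (Σ i, Fin (k i + 1))

/-- The value of the cocycle on the edge from the `t`-th inner vertex of the disc of `w` to the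
outer vertex `v`. The inner vertex sees the three successive vertices `2 * t`, `2 * t + 1`,
`2 * t + 2` of the path, which are distinct when `w` is reduced. -/
def innerStep (w : ℕ → Fin n × Bool) (t : ℕ) (v : OuterVertex n) : Fin n → ℤ :=
  if v = pathVertex w (2 * t) then pathSum w (2 * t)
  else if v = pathVertex w (2 * t + 1) then pathSum w (2 * t + 1)
  else pathSum w (2 * t + 2)

lemma innerStep_pathVertex {w : ℕ → Fin n × Bool} (hw : IsReduced w) (t : ℕ) {d : ℕ} (hd : d ≤ 2) :
    innerStep w t (pathVertex w (2 * t + d)) = pathSum w (2 * t + d) := by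
  interval_cases d
  · simp [innerStep]
  · rw [innerStep, if_neg (pathVertex_add_one_ne w (2 * t)), if_pos rfl]
  · rw [innerStep, if_neg (pathVertex_add_two_ne hw (2 * t)),
      if_neg (pathVertex_add_one_ne w (2 * t + 1))]

variable (L : Fin m → ℕ → Fin n × Bool) (k : Fin m → ℕ)

/-- Being equal or adjacent in the complex of the words `L`. -/
def vertexAdj : Vertex n k → Vertex n k → Prop
  | .inl a, .inl b => outerAdj a b
  | .inr x, .inl a => ∃ d ≤ 2, a = pathVertex (L x.1) (2 * x.2 + d)
  | .inl a, .inr x => ∃ d ≤ 2, a = pathVertex (L x.1) (2 * x.2 + d)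
  | .inr x, .inr y => x.1 = y.1

/-- The integral cochain on the complex of the words `L`. It vanishes between the inner vertices
of a disc. Once the sums of the words are divided out it becomes a cocycle. -/
def vertexStep : Vertex n k → Vertex n k → (Fin n → ℤ)
  | .inl a, .inl b => outerStep a b
  | .inr x, .inl a => innerStep (L x.1) x.2 a
  | .inl a, .inr x => -innerStep (L x.1) x.2 a
  | .inr _, .inr _ => 0

lemma vertexAdj_refl (a : Vertex n k) : vertexAdj L k a a := by
  rcases a with a | x
  · exact outerAdj_refl a
  · rfl

variable {k} in
lemma vertexAdj_symm (a b : Vertex n k) (h : vertexAdj L k a b) : vertexAdj L k b a := by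
  rcases a with a | x <;> rcases b with b | y
  · exact outerAdj_symm h
  · exact h
  · exact h
  · exact Eq.symm h

variable {k} in
lemma vertexStep_swap (a b : Vertex n k) : vertexStep L k b a = -vertexStep L k a b := by
  rcases a with a | x <;> rcases b with b | y
  · exact outerStep_swap a b
  · simp [vertexStep]
  · simp [vertexStep]
  · simp [vertexStep]

variable {k} in
lemma vertexStep_self (a : Vertex n k) : vertexStep L k a a = 0 := by
  rcases a with a | x
  · rcases a with _ | x <;> simp [vertexStep, outerStep]
  · rfl

/-- A function `U` on pairs of vertices that behaves like a cocycle on the flat complex of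
`vertexAdj` and `π ∘ vertexStep`: it is antisymmetric, and additive along flat triangles. -/
structure IsEdgeCocycle {A G : Type*} [AddCommGroup A] [AddCommGroup G] (π : (Fin n → ℤ) →+ A)
    (U : Vertex n k → Vertex n k → G) : Prop where
  swap : ∀ a b, U b a = -U a b
  add : ∀ a b c, vertexAdj L k a b → vertexAdj L k b c → vertexAdj L k a c →
    π (vertexStep L k a b) + π (vertexStep L k b c) = π (vertexStep L k a c) →
    U a b + U b c = U a c

variable {A G : Type*} [AddCommGroup A] [AddCommGroup G] {k}

/-- The value of `U` along a path from the base vertex to a given vertex. -/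
def treePath (U : Vertex n k → Vertex n k → G) : Vertex n k → G
  | .inl none => 0
  | .inl (some x) => U (.inl none) (.inl (some x))
  | .inr x => U (.inl none) (.inr ⟨x.1, 0⟩) + U (.inr ⟨x.1, 0⟩) (.inr x)

/-- The value of `U` along the combination of the triangles of the wedge with coefficients `c`. -/
def loopSum (U : Vertex n k → Vertex n k → G) : (Fin n → ℤ) →ₗ[ℤ] G :=
  Fintype.linearCombination ℤ fun j =>
    U (.inl none) (.inl (some (j, true))) + U (.inl (some (j, true))) (.inl (some (j, false))) +
      U (.inl (some (j, false))) (.inl none)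

namespace IsEdgeCocycle

variable {L} {π : (Fin n → ℤ) →+ A} {U : Vertex n k → Vertex n k → G}

lemma self (h : IsEdgeCocycle L k π U) (a : Vertex n k) : U a a = 0 := by
  simpa using h.add a a a (vertexAdj_refl L k a) (vertexAdj_refl L k a) (vertexAdj_refl L k a)
    (by simp [vertexStep_self])

lemma outer_eq (h : IsEdgeCocycle L k π U) {a b : OuterVertex n} (hab : outerAdj a b) :
    U (.inl a) (.inl b) =
      treePath U (.inl b) - treePath U (.inl a) + loopSum U (outerStep a b) := by
  rcases a with _ | ⟨j, s⟩ <;> rcases b with _ | ⟨j', s'⟩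
  · simp [treePath, outerStep, h.self]
  · simp [treePath, outerStep]
  · simp [treePath, outerStep, h.swap (.inl none)]
  · obtain rfl : j = j' := hab
    have h1 := h.swap (.inl none) (.inl (some (j, false)))
    have h2 := h.swap (.inl (some (j, true))) (.inl (some (j, false)))
    cases s <;> cases s' <;>
      simp only [treePath, outerStep, letterVec, loopSum, h.self, h1, h2, ne_eq, reduceCtorEq,
        not_true_eq_false, not_false_eq_true, and_true, and_false, if_true, if_false, map_zero,
        Fintype.linearCombination_apply_single, one_smul, neg_smul, Bool.false_eq_true] <;> abel

lemma inner_add (h : IsEdgeCocycle L k π U) (i : Fin m) (s t u : Fin (k i + 1)) :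
    U (.inr ⟨i, s⟩) (.inr ⟨i, t⟩) + U (.inr ⟨i, t⟩) (.inr ⟨i, u⟩) =
      U (.inr ⟨i, s⟩) (.inr ⟨i, u⟩) :=
  h.add _ _ _ rfl rfl rfl (by simp [vertexStep])

lemma inner_eq (h : IsEdgeCocycle L k π U) (i : Fin m) (s t : Fin (k i + 1)) :
    U (.inr ⟨i, s⟩) (.inr ⟨i, t⟩) = treePath U (.inr ⟨i, t⟩) - treePath U (.inr ⟨i, s⟩) := by
  rw [treePath, treePath, ← h.inner_add i 0 s t]
  abel

/-- Moving along the path by one step, through the triangle at an inner vertex that sees both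
ends of the step. -/
lemma step_eq (h : IsEdgeCocycle L k π U) {i : Fin m} (hw : IsReduced (L i)) (t : Fin (k i + 1))
    {d : ℕ} (hd : d ≤ 1)
    (ht : U (.inr ⟨i, t⟩) (.inl (pathVertex (L i) (2 * t + d))) =
      treePath U (.inl (pathVertex (L i) (2 * t + d))) - treePath U (.inr ⟨i, t⟩) +
        loopSum U (pathSum (L i) (2 * t + d))) :
    U (.inr ⟨i, t⟩) (.inl (pathVertex (L i) (2 * t + d + 1))) =
      treePath U (.inl (pathVertex (L i) (2 * t + d + 1))) - treePath U (.inr ⟨i, t⟩) +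
        loopSum U (pathSum (L i) (2 * t + d + 1)) := by
  have hstep := outerStep_pathVertex (L i) (2 * t + d)
  rw [← h.add (.inr ⟨i, t⟩) (.inl (pathVertex (L i) (2 * t + d)))
      (.inl (pathVertex (L i) (2 * t + d + 1))) ⟨d, by omega, rfl⟩
      (outerAdj_pathVertex _ _) ⟨d + 1, by omega, rfl⟩, ht, h.outer_eq (outerAdj_pathVertex _ _),
    hstep, map_sub]
  · abel
  · simp only [vertexStep]
    rw [hstep, innerStep_pathVertex hw t (by omega : d ≤ 2), add_assoc (2 * (t : ℕ)),
      innerStep_pathVertex hw t (by omega : d + 1 ≤ 2), map_sub]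
    abel

lemma inner_outer_eq (h : IsEdgeCocycle L k π U) {i : Fin m} (hw : IsReduced (L i)) (t : ℕ)
    (ht : t < k i + 1) {d : ℕ} (hd : d ≤ 2) :
    U (.inr ⟨i, t, ht⟩) (.inl (pathVertex (L i) (2 * t + d))) =
      treePath U (.inl (pathVertex (L i) (2 * t + d))) - treePath U (.inr ⟨i, t, ht⟩) +
        loopSum U (pathSum (L i) (2 * t + d)) := by
  have key : ∀ (t : ℕ) (ht : t < k i + 1),
      (U (.inr ⟨i, t, ht⟩) (.inl (pathVertex (L i) (2 * t))) =
        treePath U (.inl (pathVertex (L i) (2 * t))) - treePath U (.inr ⟨i, t, ht⟩) +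
          loopSum U (pathSum (L i) (2 * t))) →
      ∀ d ≤ 2, U (.inr ⟨i, t, ht⟩) (.inl (pathVertex (L i) (2 * t + d))) =
        treePath U (.inl (pathVertex (L i) (2 * t + d))) - treePath U (.inr ⟨i, t, ht⟩) +
          loopSum U (pathSum (L i) (2 * t + d)) := by
    intro t ht h0 d hd
    induction d with
    | zero => exact h0
    | succ d ih => exact h.step_eq hw ⟨t, ht⟩ (by omega) (ih (by omega))
  refine key t ht ?_ d hd
  clear hd d
  induction t with
  | zero =>
    have h1 : pathVertex (L i) (2 * 0) = none := pathVertex_zero_add _ 0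
    have h2 : pathSum (L i) (2 * 0) = 0 := by simp [pathSum, wordSum]
    rw [h1, h2, map_zero, h.swap (.inl none)]
    simp [treePath, h.self]
  | succ t ih =>
    -- the triangle on two successive inner vertices and the path vertex that both see
    have h2 := key t (by omega) (ih (by omega)) 2 le_rfl
    have e : 2 * (t + 1) = 2 * t + 2 := by ring
    have e' : pathVertex (L i) (2 * t + 2) = pathVertex (L i) (2 * (t + 1) + 0) := by
      rw [← e, add_zero]
    rw [e, ← h.add (.inr ⟨i, t + 1, ht⟩) (.inr ⟨i, t, by omega⟩)
        (.inl (pathVertex (L i) (2 * t + 2))) rfl ⟨2, le_rfl, rfl⟩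
        ⟨0, by omega, e'⟩, h2, h.inner_eq]
    · abel
    · have h3 := innerStep_pathVertex hw t (le_refl 2)
      have h4 := innerStep_pathVertex hw (t + 1) (Nat.zero_le 2)
      rw [add_zero, e] at h4
      simp only [vertexStep]
      rw [h3, h4, map_zero, zero_add]

/-- Up to the coboundary of `treePath`, the value of `U` on an edge is the combination of its values
on the triangles of the wedge with the coefficients given by `vertexStep`. -/
lemma eq_of_adj (h : IsEdgeCocycle L k π U) (hw : ∀ i, IsReduced (L i)) {a b : Vertex n k}
    (hab : vertexAdj L k a b) :
    U a b = treePath U b - treePath U a + loopSum U (vertexStep L k a b) := by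
  rcases a with a | ⟨i, t⟩ <;> rcases b with b | ⟨i', t'⟩
  · exact h.outer_eq hab
  · obtain ⟨d, hd, rfl⟩ := hab
    have := h.inner_outer_eq (hw i') t' t'.2 hd
    rw [h.swap (.inr _), this]
    simp only [vertexStep]
    rw [innerStep_pathVertex (hw i') _ hd, map_neg]
    abel
  · obtain ⟨d, hd, rfl⟩ := hab
    simp only [vertexStep]
    rw [innerStep_pathVertex (hw i) _ hd]
    exact h.inner_outer_eq (hw i) t t.2 hd
  · obtain rfl : i = i' := hab
    simp [vertexStep, h.inner_eq]

/-- The disc of a word bounds the sum of the word. The last inner vertex sees the end of the path,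
which is the base vertex; the triangle on these two and the first inner vertex closes the disc. -/
lemma loopSum_wordSum (h : IsEdgeCocycle L k π U) {i : Fin m} (hw : IsReduced (L i)) {N : ℕ}
    (hk : k i = 3 * N / 2) (hN : π (wordSum (L i) N) = 0) : loopSum U (wordSum (L i) N) = 0 := by
  obtain ⟨d, hd, hd'⟩ : ∃ d ≤ 2, 2 * k i + d = 3 * N := ⟨3 * N - 2 * k i, by omega, by omega⟩
  have h1 := h.inner_outer_eq hw (k i) (by omega) hd
  have h2 := innerStep_pathVertex hw (k i) hd
  have h3 := innerStep_pathVertex hw 0 (Nat.zero_le 2)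
  have h4 : pathSum (L i) (3 * N) = wordSum (L i) N := by
    rw [pathSum, show (3 * N + 1) / 3 = N by omega]
  have h5 : pathVertex (L i) (2 * 0 + 0) = none := pathVertex_zero_add _ 0
  have h6 : pathSum (L i) (2 * 0 + 0) = 0 := by simp [pathSum, wordSum]
  rw [hd', h4, pathVertex_zero_add] at h1 h2
  rw [h5, h6] at h3
  have h7 := h.add (.inr ⟨i, k i, by omega⟩) (.inr ⟨i, 0⟩) (.inl none) rfl
    ⟨0, by omega, h5.symm⟩ ⟨d, hd, by rw [hd', pathVertex_zero_add]⟩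
    (by simp only [vertexStep]; rw [h2, Fin.val_zero, h3, hN]; simp)
  rw [h1, h.inner_eq, h.swap (.inl none)] at h7
  simp only [treePath, h.self, add_zero, zero_sub] at h7
  have h8 := sub_eq_zero.2 h7.symm
  rw [← h8]
  abel

end IsEdgeCocycle

end Vertex


section Complex

variable {m n : ℕ} {A : Type*} [AddCommGroup A] (L : Fin m → ℕ → Fin n × Bool) (k : Fin m → ℕ)
  (π : (Fin n → ℤ) →+ A) {ι : Type*} (e : Vertex n k ≃ ι)

/-- The complex of the words `L`, with its vertices numbered by `e`. -/
def wordComplex : AbstractSimplicialComplex ι :=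
  flatComplex (fun x y => vertexAdj L k (e.symm x) (e.symm y))
    (fun x y => π (vertexStep L k (e.symm x) (e.symm y))) (fun _ => vertexAdj_refl L k _)
    (fun _ => by rw [vertexStep_self, map_zero])

variable {L k π e}

lemma triple_mem_wordComplex [DecidableEq ι] {a b c : Vertex n k} (hab : vertexAdj L k a b)
    (hbc : vertexAdj L k b c) (hac : vertexAdj L k a c)
    (h : π (vertexStep L k a b) + π (vertexStep L k b c) = π (vertexStep L k a c)) :
    {e a, e b, e c} ∈ (wordComplex L k π e).faces :=
  triple_mem_flatComplex (fun _ _ => vertexAdj_symm L _ _)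
    (fun _ _ => by rw [vertexStep_swap, map_neg])
    (by simpa using hab) (by simpa using hbc) (by simpa using hac) (by simpa using h)

lemma pair_mem_wordComplex [DecidableEq ι] {a b : Vertex n k} (hab : vertexAdj L k a b) :
    {e a, e b} ∈ (wordComplex L k π e).faces := by
  have := triple_mem_wordComplex (e := e) (π := π) hab (vertexAdj_refl L k b) hab
    (by rw [vertexStep_self, map_zero, add_zero])
  simpa using this

lemma hasDimension_wordComplex (hm : 0 < m) (hL : ∀ i, IsReduced (L i)) :
    HasDimension (wordComplex L k π e) 2 := by
  classical
  refine ⟨fun s hs => hs.2.1, ?_⟩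
  -- the first inner vertex of the first disc with the first two vertices of its path
  let i : Fin m := ⟨0, hm⟩
  let x : Vertex n k := .inr ⟨i, 0⟩
  have h0 := innerStep_pathVertex (hL i) 0 (Nat.zero_le 2)
  have h1 := innerStep_pathVertex (hL i) 0 one_le_two
  refine ⟨{e x, e (.inl (pathVertex (L i) (2 * 0 + 0))), e (.inl (pathVertex (L i) (2 * 0 + 1)))},
    triple_mem_wordComplex ⟨0, by omega, rfl⟩ (outerAdj_pathVertex (L i) 0) ⟨1, by omega, rfl⟩ ?_,
    ?_⟩
  · simp only [x, vertexStep]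
    rw [Fin.val_zero, h0, h1, add_zero, outerStep_pathVertex, map_sub, add_sub_cancel]
  · have hne := pathVertex_add_one_ne (L i) 0
    exact Finset.card_eq_three.2 ⟨_, _, _, e.injective.ne (by simp [x]),
      e.injective.ne (by simp [x]), e.injective.ne fun h => hne (Sum.inl.inj h).symm, rfl⟩

variable [LinearOrder ι]

lemma isEdgeCocycle_edgeClass :
    IsEdgeCocycle L k π fun a b => edgeClass (wordComplex L k π e) (e a) (e b) where
  swap a b := edgeClass_swap _ _ _
  add a b c hab hbc hac h := edgeClass_add (triple_mem_wordComplex hab hbc hac h)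
    (by simp) (by simp) (by simp)

/-- The complex of reduced words has first homology group `ℤⁿ` modulo the sums of the words. -/
theorem homology_wordComplex {N : Fin m → ℕ} (hk : ∀ i, k i = 3 * N i / 2)
    (hL : ∀ i, IsReduced (L i)) (hπ : Function.Surjective π)
    (hzero : ∀ i, π (wordSum (L i) (N i)) = 0)
    (hker : ∀ c, π c = 0 → c ∈ AddSubgroup.closure (Set.range fun i => wordSum (L i) (N i))) :
    Nonempty (Homology (wordComplex L k π e) 1 ≃+ A) := by
  have hU := isEdgeCocycle_edgeClass (L := L) (k := k) (π := π) (e := e)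
  have hadj : ∀ j, {e (.inl none), e (.inl (some (j, true)))} ∈ (wordComplex L k π e).faces ∧
      {e (.inl (some (j, true))), e (.inl (some (j, false)))} ∈ (wordComplex L k π e).faces ∧
      {e (.inl (some (j, false))), e (.inl none)} ∈ (wordComplex L k π e).faces := fun j =>
    ⟨pair_mem_wordComplex (a := .inl none) (b := .inl (some (j, true))) trivial,
      pair_mem_wordComplex (a := .inl (some (j, true))) (b := .inl (some (j, false))) rfl,
      pair_mem_wordComplex (a := .inl (some (j, false))) (b := .inl none) trivial⟩
  set U : Vertex n k → Vertex n k → _ := fun a b => edgeClass (wordComplex L k π e) (e a) (e b)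
    with hUdef
  refine nonempty_homology_equiv (K := wordComplex L k π e)
    (φ := fun x y => π (vertexStep L k (e.symm x) (e.symm y))) (fun s hs => hs.2.2.2)
    (loopSum U).toAddMonoidHom π (fun x => treePath U (e.symm x)) ?_ ?_ ?_ hπ ?_
  · intro c
    change boundaryLift _ (loopSum U c) = 0
    rw [loopSum, Fintype.linearCombination_apply, map_sum]
    refine Finset.sum_eq_zero fun j _ => ?_
    rw [map_smul, map_add, map_add, hUdef,
      boundaryLift_edgeClass (hadj j).1, boundaryLift_edgeClass (hadj j).2.1,
      boundaryLift_edgeClass (hadj j).2.2]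
    simp
  · intro x y hxy
    refine ⟨vertexStep L k (e.symm x) (e.symm y), ?_⟩
    have h := hU.eq_of_adj hL (hxy.2.2.1 x (by simp) y (by simp))
    simp only [hUdef, Equiv.apply_symm_apply] at h
    rw [h]
    change loopSum U _ = _
    abel
  · intro c
    change cocycleLift _ (loopSum U c) = π c
    rw [loopSum, Fintype.linearCombination_apply, map_sum]
    conv_rhs => rw [← Finset.univ_sum_single c, map_sum]
    refine Finset.sum_congr rfl fun j _ => ?_
    rw [map_smul, map_add, map_add, hUdef,
      cocycleLift_edgeClass _ (hadj j).1, cocycleLift_edgeClass _ (hadj j).2.1,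
      cocycleLift_edgeClass _ (hadj j).2.2]
    simp only [Equiv.symm_apply_apply, vertexStep, outerStep, map_zero, zero_add, add_zero]
    rw [← map_zsmul]
    congr 1
    simp [letterVec, ← Pi.single_smul]
  · intro c hc
    have hle : AddSubgroup.closure (Set.range fun i => wordSum (L i) (N i)) ≤
        (loopSum U).toAddMonoidHom.ker := by
      rw [AddSubgroup.closure_le]
      rintro _ ⟨i, rfl⟩
      exact hU.loopSum_wordSum (hL i) (hk i) (hzero i)
    exact hle (hker c hc)

end Complex

/-! ### The cokernel of a matrix with a given Smith normal form -/

section Matrix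

open Matrix

variable {m n : ℕ}

lemma vecMul_diagMatrix {r : ℕ} (hr : r ≤ m) (α : Fin r → ℤ) (y : Fin m → ℤ) (j : Fin n) :
    (y ᵥ* diagMatrix m n α) j =
      if h : (j : ℕ) < r then y ⟨j, h.trans_le hr⟩ * α ⟨j, h⟩ else 0 := by
  simp only [Matrix.vecMul, dotProduct, diagMatrix, Matrix.of_apply]
  split_ifs with h
  · rw [Finset.sum_eq_single ⟨j, h.trans_le hr⟩]
    · simp [h]
    · intro i _ hi
      rw [dif_neg (fun h' => hi (Fin.ext h'.1)), mul_zero]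
    · simp
  · refine Finset.sum_eq_zero fun i _ => ?_
    rw [dif_neg (by omega), mul_zero]

/-- The quotient of `ℤⁿ` by the rows of `M`, read off a Smith normal form. -/
lemma exists_hom_of_isSmithNormalForm {M : Matrix (Fin m) (Fin n) ℤ} {r : ℕ} {α : Fin r → ℤ}
    (hα : IsSmithNormalForm M r α) :
    ∃ π : (Fin n → ℤ) →+ ((i : Fin r) → ℤ ⧸ Ideal.span {α i}) × (Fin (n - r) → ℤ),
      Function.Surjective π ∧ (∀ i, π (M i) = 0) ∧
      ∀ c, π c = 0 → c ∈ AddSubgroup.closure (Set.range M) := by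
  obtain ⟨S, T, hS, hT, hM⟩ := hα.eq_mul
  have hr := hα.le_rows
  have hrn := hα.le_cols
  obtain ⟨S', hS'⟩ := hS.exists_left_inv
  obtain ⟨T', hT'⟩ := hT.exists_right_inv
  have hT'' : T' * T = 1 := mul_eq_one_comm.1 hT'
  let π : (Fin n → ℤ) →+ ((i : Fin r) → ℤ ⧸ Ideal.span {α i}) × (Fin (n - r) → ℤ) :=
    { toFun := fun c =>
        (fun i => Ideal.Quotient.mk (Ideal.span {α i}) ((c ᵥ* T') ⟨i, i.2.trans_le hrn⟩),
          fun j => (c ᵥ* T') ⟨r + j, by omega⟩)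
      map_zero' := by
        ext <;> simp
      map_add' := fun c d => by
        ext <;> simp [Matrix.add_vecMul] }
  refine ⟨π, ?_, ?_, ?_⟩
  · rintro ⟨x, y⟩
    choose z hz using fun i => Ideal.Quotient.mk_surjective (x i)
    let d : Fin n → ℤ := fun j => if h : (j : ℕ) < r then z ⟨j, h⟩ else y ⟨j - r, by omega⟩
    have hd : (d ᵥ* T) ᵥ* T' = d := by rw [Matrix.vecMul_vecMul, hT', Matrix.vecMul_one]
    refine ⟨d ᵥ* T, Prod.ext (funext fun i => ?_) (funext fun j => ?_)⟩
    · change Ideal.Quotient.mk _ (((d ᵥ* T) ᵥ* T') _) = _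
      rw [hd]
      simp [d, hz]
    · change ((d ᵥ* T) ᵥ* T') _ = _
      rw [hd]
      simp [d]
  · intro i
    have h : M i ᵥ* T' = S i ᵥ* diagMatrix m n α := by
      have h1 : M * T' = S * diagMatrix m n α := by
        rw [hM, Matrix.mul_assoc, hT', Matrix.mul_one]
      exact congrFun h1 i
    refine Prod.ext (funext fun j => ?_) (funext fun j => ?_)
    · change Ideal.Quotient.mk _ ((M i ᵥ* T') _) = 0
      rw [h, vecMul_diagMatrix hr, dif_pos j.2, Ideal.Quotient.eq_zero_iff_mem,
        Ideal.mem_span_singleton]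
      exact Dvd.intro_left _ rfl
    · change (M i ᵥ* T') _ = 0
      rw [h, vecMul_diagMatrix hr, dif_neg (by simp)]
  · intro c hc
    have h1 : ∀ i : Fin r, α i ∣ (c ᵥ* T') ⟨i, i.2.trans_le hrn⟩ := fun i => by
      have : Ideal.Quotient.mk (Ideal.span {α i}) ((c ᵥ* T') ⟨i, i.2.trans_le hrn⟩) = 0 :=
        congrFun (congrArg Prod.fst hc) i
      rwa [Ideal.Quotient.eq_zero_iff_mem, Ideal.mem_span_singleton] at this
    have h2 : ∀ j : Fin (n - r), (c ᵥ* T') ⟨r + j, by omega⟩ = 0 := fun j =>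
      congrFun (congrArg Prod.snd hc) j
    choose y hy using h1
    let d : Fin m → ℤ := fun i => if h : (i : ℕ) < r then y ⟨i, h⟩ else 0
    have hd : c ᵥ* T' = d ᵥ* diagMatrix m n α := by
      funext j
      rw [vecMul_diagMatrix hr]
      split_ifs with h
      · rw [hy ⟨j, h⟩]
        simp [d, h, mul_comm]
      · have := h2 ⟨j - r, by omega⟩
        rw [← this]
        congr 1
        exact Fin.ext (by simp; omega)
    have hc' : c = (d ᵥ* S') ᵥ* M := by
      rw [hM, Matrix.vecMul_vecMul, ← Matrix.mul_assoc, ← Matrix.mul_assoc, hS', Matrix.one_mul,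
        ← Matrix.vecMul_vecMul, ← hd, Matrix.vecMul_vecMul, hT'', Matrix.vecMul_one]
    rw [hc', Matrix.vecMul_eq_sum]
    exact sum_mem fun i _ => zsmul_mem (AddSubgroup.subset_closure (Set.mem_range_self i)) _

end Matrix

end SimplicialTorsion

theorem proposition1 (m n : ℕ) (hm : 0 < m) (hn : 0 < n) (M : Matrix (Fin m) (Fin n) ℤ)
    (r : ℕ) (α : Fin r → ℤ) (hα : SimplicialTorsion.IsSmithNormalForm M r α) :
    ∃ (V : ℕ) (K : AbstractSimplicialComplex (Fin V)),
      SimplicialTorsion.HasDimension K 2 ∧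
      (V : ℚ) ≤ 2 * n + m + 1 + 3 / 2 * ∑ i, ∑ j, |(M i j : ℚ)| ∧
      Nonempty (SimplicialTorsion.Homology K 1 ≃+
        (((i : Fin r) → ℤ ⧸ Ideal.span {α i}) × (Fin (n - r) → ℤ))) := by
  open SimplicialTorsion in
  obtain ⟨π, hπ, hzero, hker⟩ := exists_hom_of_isSmithNormalForm hα
  choose L hL hsum using fun i => exists_reduced_word hn (M i)
  let N : Fin m → ℕ := fun i => ∑ j, (M i j).natAbs
  let k : Fin m → ℕ := fun i => 3 * N i / 2
  let e : Vertex n k ≃ Fin (Fintype.card (Vertex n k)) := Fintype.equivFin _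
  refine ⟨_, wordComplex L k π e, hasDimension_wordComplex hm hL, ?_,
    homology_wordComplex (N := N) (fun _ => rfl) hL hπ (fun i => ?_) fun c hc => ?_⟩
  · have hcard : Fintype.card (Vertex n k) = n * 2 + 1 + ∑ i, (k i + 1) := by
      simp [Vertex, OuterVertex]
    have hk : ∀ i, (k i : ℚ) ≤ 3 / 2 * ∑ j, |(M i j : ℚ)| := fun i => by
      have h1 : (k i : ℚ) ≤ ((3 * N i : ℕ) : ℚ) / (2 : ℕ) := Nat.cast_div_le
      have h2 : (N i : ℚ) = ∑ j, |(M i j : ℚ)| := by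
        simp [N, Nat.cast_natAbs]
      rw [← h2]
      push_cast at h1
      linarith
    have hk' := Finset.sum_le_sum fun i (_ : i ∈ Finset.univ) => hk i
    rw [← Finset.mul_sum] at hk'
    rw [hcard]
    push_cast
    rw [Finset.sum_add_distrib]
    simp only [Finset.sum_const, Finset.card_univ, Fintype.card_fin, nsmul_eq_mul, mul_one]
    linarith
  · rw [hsum i]
    exact hzero i
  · have h : (fun i => wordSum (L i) (N i)) = M := funext hsum
    rw [h]
    exact hker c hc
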